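/- Call $f\colon\mathbb N\to\mathbb R$ lower semicomputable if there is a computable function $q\colon\mathbb N\times\mathbb N\to\mathbb Q$, non-decreasing in its second argument, with $f(i)=\lim_n q(i,n)$ for every $i$. A lower semicomputable semimeasure is a lower semicomputable $m\colon\mathbb N\to[0,\infty)$ with $\sum_i m_i\le 1$; it is universal if for every lower semicomputable semimeasure $u$ there is $c>0$ with $u_i\le c\,m_i$ for all $i$. Let $m$ be a universal semimeasure. Let $r_0,r_1,\ldots$ be non-negative rational numbers such that $r_i=\lim_n r(i,n)$, where $r\colon\mathbb N\times\mathbb N\to\mathbb Q$ is computable, $r(i,n)$ is non-decreasing in $n$, and for every $i$ there are only finitely many different values $r(i,n)$, $n\in\mathbb N$. Assume that the series $\sum_i r_i$ converges, and let $\alpha=\sum_i r_i$. Then $\alpha$ is Martin-Löf random if and only if the series converges slowly in the Solovay sense, that is, $r_i=O(m_i)$ and there is $\varepsilon>0$ such that $r_i\ge\varepsilon m_i$ for infinitely many $i$. Equivalently, $\alpha$ is Martin-Löf random if and only if $r_i/m_i$ does not converge to $0$. (A real $x$ is Martin-Löf random if there is no sequence of sets $U_n=\bigcup_k(a_{n,k},b_{n,k})$,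 with $(n,k)\mapsto a_{n,k}$ and $(n,k)\mapsto b_{n,k}$ computable rational-valued functions and $U_n$ of Lebesgue measure at most $2^{-n}$ for every $n$, such that $x\in\bigcap_n U_n$.) -/

import Mathlib

open Filter Topology MeasureTheory

/-- A computable rational-valued function: the value is written as `(p - q) / (d + 1)` with
computable natural-number valued `p`, `q`, `d`. -/
def ComputableRat {ι : Type} [Primcodable ι] (f : ι → ℚ) : Prop :=
  ∃ p q d : ι → ℕ, Computable p ∧ Computable q ∧ Computable d ∧
    ∀ a, f a = ((p a : ℚ) - (q a : ℚ)) / ((d a : ℚ) + 1)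

/-- The effectively open subset of the line that is the union of the rational intervals
`(a k, b k)` (empty when `b k ≤ a k`). -/
def intervalUnion (a b : ℕ → ℚ) : Set ℝ :=
  ⋃ k : ℕ, Set.Ioo (a k : ℝ) (b k : ℝ)

/-- A Martin-Löf test on the real line: a uniformly effective sequence of effectively open sets,
the `n`-th of which has Lebesgue measure at most `2⁻ⁿ`. -/
def IsMartinLofTest (a b : ℕ → ℕ → ℚ) : Prop :=
  ComputableRat (fun x : ℕ × ℕ => a x.1 x.2) ∧
  ComputableRat (fun x : ℕ × ℕ => b x.1 x.2) ∧
  ∀ n, volume (intervalUnion (a n) (b n)) ≤ (2⁻¹ : ENNReal) ^ n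

/-- A real is Martin-Löf random if no Martin-Löf test captures it at all levels. -/
def IsMartinLofRandom (x : ℝ) : Prop :=
  ∀ a b : ℕ → ℕ → ℚ, IsMartinLofTest a b → ∃ n, x ∉ intervalUnion (a n) (b n)

/-- `f i` is a lower semicomputable real, uniformly in `i`. -/
def LowerSemicomputable (f : ℕ → ℝ) : Prop :=
  ∃ q : ℕ → ℕ → ℚ, ComputableRat (fun x : ℕ × ℕ => q x.1 x.2) ∧
    ∀ i, Monotone (q i) ∧ Tendsto (fun n => (q i n : ℝ)) atTop (𝓝 (f i))

/-- A lower semicomputable semimeasure on the natural numbers. -/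
structure IsLowerSemicomputableSemimeasure (m : ℕ → ℝ) : Prop where
  lowerSemicomputable : LowerSemicomputable m
  nonneg : ∀ i, 0 ≤ m i
  summable : Summable m
  tsum_le_one : ∑' i, m i ≤ 1

/-- A universal semimeasure (a priori probability): a lower semicomputable semimeasure that is
maximal up to a constant factor among all of them. -/
def IsUniversalSemimeasure (m : ℕ → ℝ) : Prop :=
  IsLowerSemicomputableSemimeasure m ∧
  ∀ u : ℕ → ℝ, IsLowerSemicomputableSemimeasure u → ∃ c : ℝ, 0 < c ∧ ∀ i, u i ≤ c * m i

/-- The rationals `r i` are limits of approximations, computable uniformly in `i`, that are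
non-decreasing and take only finitely many different values for each `i`. -/
def FinitelyApproximable (r : ℕ → ℚ) : Prop :=
  ∃ q : ℕ → ℕ → ℚ, ComputableRat (fun x : ℕ × ℕ => q x.1 x.2) ∧
    ∀ i, Monotone (q i) ∧ (Set.range (q i)).Finite ∧
      Tendsto (fun n => (q i n : ℝ)) atTop (𝓝 (r i : ℝ))

/-- Slow convergence in the Solovay sense of the series with terms `r i ≥ 0`: the bound
`r i = O(m i)` holds and is tight, up to a constant factor, infinitely often. -/
def ConvergesSlowly (m : ℕ → ℝ) (r : ℕ → ℚ) : Prop :=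
  (∃ C : ℝ, ∀ i, (r i : ℝ) ≤ C * m i) ∧
  ∃ ε : ℝ, 0 < ε ∧ ∃ᶠ i in atTop, ε * m i ≤ (r i : ℝ)

/-! Let `S t = stageSum p t`, a computable non-decreasing sequence of rationals tending to `α`,
where the `i`-th term is still zero at all stages `t ≤ i`. Each direction turns steps `S t → S (t +
1)` into mass and charges it to the terms that grow.

If a test captures `α`, call a step captured at level `2n + 1` when it lies inside one interval of
that level. Captured increments total at most `2⁻¹ ^ (2n + 1)`, so with weights `2 ^ n`, summed over
`n`, they form a lower semicomputable semimeasure `u`. From some stage on every step is captured, so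
`u i ≥ 2 ^ n * r i` for all large `i`. Universality gives `r i / m i → 0`
(`tendsto_ratio_zero_of_captured`).

Conversely, let `r i / m i → 0` and let `ε` be the scale of level `n`. Count only increments of
terms whose value is still at most `ε * m i`: together with a summable padding their mass is `O(ε)`.
After the finitely many exceptional terms have stabilised, every step is counted in full, so a block
of masses starting there reaches past `α`. The maximal inequality `volume_iUnion_Ioo_le_total_mass`
bounds the points reached by such blocks, although the stage at which blocks become correct is not
computable. Thus the reached points form a test (`exists_test_of_tendsto_ratio_zero`). -/

/-! ### Arithmetic of computable rational-valued functions -/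

namespace ComputableRat

variable {ι κ : Type} [Primcodable ι] [Primcodable κ]

/-- The rational number represented by a triple of natural numbers. -/
def ofTriple (x : ℕ × ℕ × ℕ) : ℚ := ((x.1 : ℚ) - (x.2.1 : ℚ)) / ((x.2.2 : ℚ) + 1)

theorem iff_exists_triple {f : ι → ℚ} :
    ComputableRat f ↔ ∃ g : ι → ℕ × ℕ × ℕ, Computable g ∧ ∀ a, f a = ofTriple (g a) := by
  constructor
  · rintro ⟨p, q, d, hp, hq, hd, h⟩
    exact ⟨fun a => (p a, q a, d a), hp.pair (hq.pair hd), h⟩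
  · rintro ⟨g, hg, h⟩
    exact ⟨_, _, _, Computable.fst.comp hg, Computable.fst.comp (Computable.snd.comp hg),
      Computable.snd.comp (Computable.snd.comp hg), h⟩

theorem comp {f : ι → ℚ} (hf : ComputableRat f) {g : κ → ι} (hg : Computable g) :
    ComputableRat fun a => f (g a) := by
  obtain ⟨p, q, d, hp, hq, hd, h⟩ := hf
  exact ⟨_, _, _, hp.comp hg, hq.comp hg, hd.comp hg, fun a => h (g a)⟩

theorem of_eq {f g : ι → ℚ} (hf : ComputableRat f) (h : ∀ a, f a = g a) : ComputableRat g := by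
  obtain rfl : f = g := funext h
  exact hf

theorem _root_.Computable.nat_add' {f g : ι → ℕ} (hf : Computable f) (hg : Computable g) :
    Computable fun a => f a + g a := Primrec.nat_add.to_comp.comp hf hg

theorem _root_.Computable.nat_mul' {f g : ι → ℕ} (hf : Computable f) (hg : Computable g) :
    Computable fun a => f a * g a := Primrec.nat_mul.to_comp.comp hf hg

theorem natCast {f : ι → ℕ} (hf : Computable f) : ComputableRat fun a => (f a : ℚ) :=
  ⟨f, fun _ => 0, fun _ => 0, hf, Computable.const 0, Computable.const 0, fun a => by simp⟩

/-- Addition of represented rationals. -/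
def addTriple (x y : ℕ × ℕ × ℕ) : ℕ × ℕ × ℕ :=
  (x.1 * (y.2.2 + 1) + y.1 * (x.2.2 + 1), x.2.1 * (y.2.2 + 1) + y.2.1 * (x.2.2 + 1),
    x.2.2 * y.2.2 + x.2.2 + y.2.2)

theorem ofTriple_addTriple (x y : ℕ × ℕ × ℕ) :
    ofTriple (addTriple x y) = ofTriple x + ofTriple y := by
  have hx : (x.2.2 : ℚ) + 1 ≠ 0 := by positivity
  have hy : (y.2.2 : ℚ) + 1 ≠ 0 := by positivity
  have hd : (x.2.2 : ℚ) * y.2.2 + x.2.2 + y.2.2 + 1 = (x.2.2 + 1) * (y.2.2 + 1) := by ring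
  simp only [ofTriple, addTriple]
  push_cast
  rw [hd]
  field_simp
  ring

theorem computable_addTriple : Computable₂ addTriple := by
  have f1 : Computable fun z : (ℕ × ℕ × ℕ) × (ℕ × ℕ × ℕ) => z.1.1 :=
    Computable.fst.comp Computable.fst
  have f2 : Computable fun z : (ℕ × ℕ × ℕ) × (ℕ × ℕ × ℕ) => z.1.2.1 :=
    Computable.fst.comp (Computable.snd.comp Computable.fst)
  have f3 : Computable fun z : (ℕ × ℕ × ℕ) × (ℕ × ℕ × ℕ) => z.1.2.2 :=
    Computable.snd.comp (Computable.snd.comp Computable.fst)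
  have g1 : Computable fun z : (ℕ × ℕ × ℕ) × (ℕ × ℕ × ℕ) => z.2.1 :=
    Computable.fst.comp Computable.snd
  have g2 : Computable fun z : (ℕ × ℕ × ℕ) × (ℕ × ℕ × ℕ) => z.2.2.1 :=
    Computable.fst.comp (Computable.snd.comp Computable.snd)
  have g3 : Computable fun z : (ℕ × ℕ × ℕ) × (ℕ × ℕ × ℕ) => z.2.2.2 :=
    Computable.snd.comp (Computable.snd.comp Computable.snd)
  have f3' := Computable.succ.comp f3
  have g3' := Computable.succ.comp g3
  exact ((f1.nat_mul' g3').nat_add' (g1.nat_mul' f3')).pair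
    (((f2.nat_mul' g3').nat_add' (g2.nat_mul' f3')).pair
      (((f3.nat_mul' g3).nat_add' f3).nat_add' g3))

theorem add {f g : ι → ℚ} (hf : ComputableRat f) (hg : ComputableRat g) :
    ComputableRat fun a => f a + g a := by
  obtain ⟨F, hF, hfF⟩ := iff_exists_triple.1 hf
  obtain ⟨G, hG, hgG⟩ := iff_exists_triple.1 hg
  exact iff_exists_triple.2 ⟨_, computable_addTriple.comp hF hG, fun a => by
    rw [ofTriple_addTriple, hfF, hgG]⟩

theorem neg {f : ι → ℚ} (hf : ComputableRat f) : ComputableRat fun a => - f a := by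
  obtain ⟨p, q, d, hp, hq, hd, h⟩ := hf
  exact ⟨q, p, d, hq, hp, hd, fun a => by simp only [h]; ring⟩

theorem sub {f g : ι → ℚ} (hf : ComputableRat f) (hg : ComputableRat g) :
    ComputableRat fun a => f a - g a :=
  (hf.add hg.neg).of_eq fun a => by ring

theorem mul {f g : ι → ℚ} (hf : ComputableRat f) (hg : ComputableRat g) :
    ComputableRat fun a => f a * g a := by
  obtain ⟨p, q, d, hp, hq, hd, h⟩ := hf
  obtain ⟨p', q', d', hp', hq', hd', h'⟩ := hg
  refine ⟨_, _, _, (hp.nat_mul' hp').nat_add' (hq.nat_mul' hq'),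
    (hp.nat_mul' hq').nat_add' (hq.nat_mul' hp'),
    ((hd.nat_mul' hd').nat_add' hd).nat_add' hd', fun a => ?_⟩
  have hx : (d a : ℚ) + 1 ≠ 0 := by positivity
  have hy : (d' a : ℚ) + 1 ≠ 0 := by positivity
  have hd : (d a : ℚ) * d' a + d a + d' a + 1 = (d a + 1) * (d' a + 1) := by ring
  simp only [h, h']
  push_cast
  rw [hd]
  field_simp
  ring

theorem posPart {f : ι → ℚ} (hf : ComputableRat f) : ComputableRat fun a => max (f a) 0 := by
  obtain ⟨p, q, d, hp, hq, hd, h⟩ := hf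
  -- Truncated subtraction of natural numbers is already the positive part of the numerator.
  refine ⟨fun a => p a - q a, fun _ => 0, d, Primrec.nat_sub.to_comp.comp hp hq,
    Computable.const 0, hd, fun a => ?_⟩
  have hx : (0 : ℚ) < (d a : ℚ) + 1 := by positivity
  simp only [h]
  rcases le_total (p a) (q a) with hpq | hpq
  · have : ((p a : ℚ) - q a) ≤ 0 := by simpa using hpq
    rw [max_eq_right (div_nonpos_of_nonpos_of_nonneg this hx.le), Nat.sub_eq_zero_of_le hpq]
    simp
  · have : 0 ≤ ((p a : ℚ) - q a) := by simpa using hpq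
    rw [max_eq_left (div_nonneg this hx.le)]
    push_cast [hpq]
    ring

theorem computable_decide_lt {f g : ι → ℚ} (hf : ComputableRat f) (hg : ComputableRat g) :
    Computable fun a => decide (f a < g a) := by
  obtain ⟨p, q, d, hp, hq, hd, h⟩ := hf.sub hg
  have : Computable fun a => decide (p a < q a) :=
    (Primrec.nat_lt.decide).to_comp.comp hp hq
  refine this.of_eq fun a => ?_
  have hx : (0 : ℚ) < (d a : ℚ) + 1 := by positivity
  refine decide_eq_decide.2 ?_
  have h' : f a - g a = _ := h a
  rw [← sub_neg (a := f a), h', div_lt_iff₀ hx, zero_mul, sub_neg, Nat.cast_lt]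

theorem ite_bool {c : ι → Bool} {f g : ι → ℚ} (hc : Computable c) (hf : ComputableRat f)
    (hg : ComputableRat g) : ComputableRat fun a => if c a = true then f a else g a := by
  obtain ⟨F, hF, hfF⟩ := iff_exists_triple.1 hf
  obtain ⟨G, hG, hgG⟩ := iff_exists_triple.1 hg
  refine iff_exists_triple.2 ⟨_, Computable.cond hc hF hG, fun a => ?_⟩
  cases h : c a <;> simp [hfF, hgG]

theorem ite_lt {f g u v : ι → ℚ} (hu : ComputableRat u) (hv : ComputableRat v)
    (hf : ComputableRat f) (hg : ComputableRat g) :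
    ComputableRat fun a => if u a < v a then f a else g a :=
  (ite_bool (computable_decide_lt hu hv) hf hg).of_eq fun a => by simp

theorem sum_range {f : ι → ℕ → ℚ} (hf : ComputableRat fun x : ι × ℕ => f x.1 x.2)
    {k : ι → ℕ} (hk : Computable k) : ComputableRat fun a => ∑ i ∈ Finset.range (k a), f a i := by
  obtain ⟨F, hF, hfF⟩ := iff_exists_triple.1 hf
  have hstep : Computable₂ fun (a : ι) (z : ℕ × (ℕ × ℕ × ℕ)) => addTriple z.2 (F (a, z.1)) :=
    computable_addTriple.comp (Computable.snd.comp Computable.snd)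
      (hF.comp (Computable.fst.pair (Computable.fst.comp Computable.snd)))
  refine iff_exists_triple.2 ⟨_, Computable.nat_rec hk (Computable.const (0, 0, 0)) hstep,
    fun a => ?_⟩
  induction k a with
  | zero => simp [ofTriple]
  | succ n ih =>
    rw [Finset.sum_range_succ, ih, ofTriple_addTriple]
    exact congrArg _ (hfF (a, n))

theorem two_pow {f : ι → ℕ} (hf : Computable f) : ComputableRat fun a => (2 : ℚ) ^ f a := by
  have h : Computable fun a => 2 ^ f a := by
    have hstep : Computable₂ fun (_ : ι) (z : ℕ × ℕ) => z.2 * 2 :=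
      (Computable.snd.comp Computable.snd).nat_mul' (Computable.const 2)
    refine (Computable.nat_rec hf (Computable.const 1) hstep).of_eq fun a => ?_
    induction f a with
    | zero => simp
    | succ n ih => rw [pow_succ, ← ih]
  exact (natCast h).of_eq fun a => by simp

theorem inv_two_pow {f : ι → ℕ} (hf : Computable f) :
    ComputableRat fun a => ((2 : ℚ)⁻¹) ^ f a := by
  -- Denominators are stored minus one, so doubling becomes `d ↦ 2 * d + 1`.
  have h : Computable fun a => 2 ^ f a - 1 := by
    have hstep : Computable₂ fun (_ : ι) (z : ℕ × ℕ) => z.2 * 2 + 1 :=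
      ((Computable.snd.comp Computable.snd).nat_mul' (Computable.const 2)).nat_add'
        (Computable.const 1)
    refine (Computable.nat_rec hf (Computable.const 0) hstep).of_eq fun a => ?_
    induction f a with
    | zero => simp
    | succ n ih =>
      have := Nat.one_le_two_pow (n := n)
      rw [pow_succ]
      simp only [ih]
      omega
  refine ⟨fun _ => 1, fun _ => 0, _, Computable.const 1, Computable.const 0, h, fun a => ?_⟩
  have := Nat.one_le_two_pow (n := f a)
  push_cast [this]
  simp

theorem const (c : ℚ) : ComputableRat fun _ : ι => c := by
  refine ⟨fun _ => c.num.toNat, fun _ => (-c.num).toNat, fun _ => c.den - 1,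
    Computable.const _, Computable.const _, Computable.const _, fun _ => ?_⟩
  have h1 : ((c.num.toNat : ℤ) : ℚ) - (((-c.num).toNat : ℤ) : ℚ) = c.num := by
    rw [← Int.cast_sub]
    congr 1
    omega
  have h2 := c.den_pos
  have h3 : ((c.den - 1 : ℕ) : ℚ) + 1 = c.den := by
    have : c.den - 1 + 1 = c.den := by omega
    exact_mod_cast this
  rw [h3]
  simp only [Int.cast_natCast] at h1
  rw [h1, Rat.num_div_den]

end ComputableRat

/-! ### Stagewise approximation of the series -/

/-- A computable array `p i t`, non-decreasing in the stage `t`, that starts from `0` for `t ≤ i`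
and reaches the value `r i` at some finite stage. -/
structure IsStagewiseApprox (p : ℕ → ℕ → ℚ) (r : ℕ → ℚ) : Prop where
  computable : ComputableRat fun x : ℕ × ℕ => p x.1 x.2
  mono : ∀ i, Monotone (p i)
  eq_zero : ∀ i t, t ≤ i → p i t = 0
  eventually_eq : ∀ i, ∀ᶠ t in atTop, p i t = r i

/-- The sum of all values present in the array at stage `t`. -/
def stageSum (p : ℕ → ℕ → ℚ) (t : ℕ) : ℚ := ∑ i ∈ Finset.range t, p i t

/-- A maximal value is attained, and monotonicity keeps the sequence there. This is the only use of
the finiteness of the set of approximations. -/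
theorem eventually_eq_of_monotone_of_finite_range {q : ℕ → ℚ} (hq : Monotone q)
    (hfin : (Set.range q).Finite) {x : ℚ}
    (hx : Tendsto (fun n => (q n : ℝ)) atTop (𝓝 (x : ℝ))) : ∀ᶠ t in atTop, q t = x := by
  obtain ⟨_, ⟨T, rfl⟩, hT⟩ :=
    hfin.exists_maximalFor id (Set.range q) (Set.range_nonempty q)
  have hc : ∀ t, T ≤ t → q t = q T := fun t ht =>
    le_antisymm (hT ⟨t, rfl⟩ (hq ht)) (hq ht)
  have h1 : Tendsto (fun n => (q n : ℝ)) atTop (𝓝 (q T : ℝ)) :=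
    tendsto_const_nhds.congr' <| (eventually_ge_atTop T).mono fun t ht => by simp [hc t ht]
  have h2 : q T = x := by exact_mod_cast tendsto_nhds_unique h1 hx
  exact (eventually_ge_atTop T).mono fun t ht => (hc t ht).trans h2

theorem FinitelyApproximable.exists_stagewiseApprox {r : ℕ → ℚ} (hr : FinitelyApproximable r)
    (hr0 : ∀ i, 0 ≤ r i) : ∃ p, IsStagewiseApprox p r := by
  obtain ⟨q, hqc, hq⟩ := hr
  refine ⟨fun i t => if i < t then max (q i t) 0 else 0, ?_, fun i s t hst => ?_,
    fun i t h => if_neg (not_lt.2 h), fun i => ?_⟩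
  · have h := ComputableRat.ite_lt (ComputableRat.natCast Computable.fst)
      (ComputableRat.natCast Computable.snd) hqc.posPart (ComputableRat.const 0)
    exact h.of_eq fun x => by simp
  · split_ifs with h1 h2
    · exact max_le_max ((hq i).1 hst) le_rfl
    · omega
    · exact le_max_right _ _
    · exact le_rfl
  · filter_upwards [eventually_gt_atTop i,
      eventually_eq_of_monotone_of_finite_range (hq i).1 (hq i).2.1 (hq i).2.2] with t ht h
    rw [if_pos ht, h, max_eq_left (hr0 i)]

namespace IsStagewiseApprox

variable {p : ℕ → ℕ → ℚ} {r : ℕ → ℚ} (hp : IsStagewiseApprox p r)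

include hp

theorem nonneg (i t : ℕ) : 0 ≤ p i t := by
  rw [← hp.eq_zero i 0 (Nat.zero_le i)]
  exact hp.mono i (Nat.zero_le t)

theorem le (i t : ℕ) : p i t ≤ r i := by
  obtain ⟨s, hs, hts⟩ := ((hp.eventually_eq i).and (eventually_ge_atTop t)).exists
  exact (hp.mono i hts).trans hs.le

theorem nonneg_limit (i : ℕ) : 0 ≤ r i := (hp.nonneg i 0).trans (hp.le i 0)

theorem increment_nonneg (i t : ℕ) : 0 ≤ p i (t + 1) - p i t :=
  sub_nonneg.2 (hp.mono i t.le_succ)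

/-- Entries with `i ≥ t` vanish, so stage sums at different stages can be compared over a common
index range. -/
theorem stageSum_eq {t k : ℕ} (h : t ≤ k) : stageSum p t = ∑ i ∈ Finset.range k, p i t := by
  refine Finset.sum_subset (Finset.range_mono h) fun i _ hi => hp.eq_zero i t ?_
  simpa using hi

theorem stageSum_succ_sub {t k : ℕ} (h : t + 1 ≤ k) :
    stageSum p (t + 1) - stageSum p t = ∑ i ∈ Finset.range k, (p i (t + 1) - p i t) := by
  rw [hp.stageSum_eq h, hp.stageSum_eq (t.le_succ.trans h), Finset.sum_sub_distrib]

theorem stageSum_mono : Monotone (stageSum p) := by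
  refine monotone_nat_of_le_succ fun t => sub_nonneg.1 ?_
  rw [hp.stageSum_succ_sub le_rfl]
  exact Finset.sum_nonneg fun i _ => hp.increment_nonneg i t

theorem computable_increment : ComputableRat fun x : ℕ × ℕ => p x.1 (x.2 + 1) - p x.1 x.2 :=
  (hp.computable.comp (Computable.fst.pair (Computable.succ.comp Computable.snd))).sub hp.computable

theorem computable_stageSum : ComputableRat (stageSum p) :=
  ComputableRat.sum_range (f := fun t i => p i t)
    (hp.computable.comp (Computable.snd.pair Computable.fst)) Computable.id

variable {α : ℝ} (hα : HasSum (fun i => (r i : ℝ)) α)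

include hα

theorem stageSum_le (t : ℕ) : (stageSum p t : ℝ) ≤ α := by
  calc (stageSum p t : ℝ) ≤ ∑ i ∈ Finset.range t, (r i : ℝ) := by
        rw [stageSum]
        push_cast
        exact Finset.sum_le_sum fun i _ => by exact_mod_cast hp.le i t
    _ ≤ α := sum_le_hasSum _ (fun i _ => by exact_mod_cast hp.nonneg_limit i) hα

theorem tendsto_stageSum : Tendsto (fun t => (stageSum p t : ℝ)) atTop (𝓝 α) := by
  refine tendsto_order.2 ⟨fun x hx => ?_, fun x hx =>
    Eventually.of_forall fun t => (hp.stageSum_le hα t).trans_lt hx⟩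
  -- A finite partial sum already exceeds `x`; once its terms have stabilised, the other entries
  -- only add to it.
  obtain ⟨k, hk⟩ := (hα.tendsto_sum_nat.eventually_const_lt hx).exists
  have hev : ∀ᶠ t in atTop, ∀ i ∈ Finset.range k, p i t = r i :=
    (eventually_all_finset _).2 fun i _ => hp.eventually_eq i
  filter_upwards [hev, eventually_ge_atTop k] with t ht hkt
  refine hk.trans_le ?_
  have : ∑ i ∈ Finset.range k, r i ≤ stageSum p t := by
    rw [← Finset.sum_congr rfl ht]
    exact Finset.sum_le_sum_of_subset_of_nonneg (Finset.range_mono hkt)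
      fun i _ _ => hp.nonneg i t
  exact_mod_cast this

end IsStagewiseApprox

/-! ### Semimeasures built from arrays, and measure of captured steps -/

theorem sum_range_inv_two_pow (k : ℕ) :
    ∑ t ∈ Finset.range k, ((2 : ℚ)⁻¹) ^ t = 2 - 2 * (2 : ℚ)⁻¹ ^ k := by
  induction k with
  | zero => simp
  | succ n ih => rw [Finset.sum_range_succ, ih]; ring

/-- Limits of bounded computable arrays are semimeasures. -/
theorem exists_semimeasure_of_array {u : ℕ → ℕ → ℚ}
    (hc : ComputableRat fun x : ℕ × ℕ => u x.1 x.2) (hmono : ∀ i, Monotone (u i))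
    (h0 : ∀ i s, 0 ≤ u i s) (hsum : ∀ k s, ∑ i ∈ Finset.range k, u i s ≤ 1) :
    ∃ v : ℕ → ℝ, IsLowerSemicomputableSemimeasure v ∧
      ∀ i, Tendsto (fun s => (u i s : ℝ)) atTop (𝓝 (v i)) := by
  have hle : ∀ i s, u i s ≤ 1 := fun i s =>
    (Finset.single_le_sum (f := fun j => u j s) (fun j _ => h0 j s)
      (Finset.mem_range.2 i.lt_succ_self)).trans (hsum (i + 1) s)
  have hmono' : ∀ i, Monotone fun s => (u i s : ℝ) := fun i s t h =>
    Rat.cast_le.2 (hmono i h)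
  have hlim : ∀ i, Tendsto (fun s => (u i s : ℝ)) atTop (𝓝 (⨆ s, (u i s : ℝ))) := fun i =>
    tendsto_atTop_ciSup (hmono' i) ⟨1, by rintro _ ⟨s, rfl⟩; beta_reduce; exact_mod_cast hle i s⟩
  have hv0 : ∀ i, (0 : ℝ) ≤ ⨆ s, (u i s : ℝ) := fun i =>
    ge_of_tendsto' (hlim i) fun s => by exact_mod_cast h0 i s
  have hvsum : ∀ k, ∑ i ∈ Finset.range k, (⨆ s, (u i s : ℝ)) ≤ 1 := fun k =>
    le_of_tendsto' (tendsto_finsetSum _ fun i _ => hlim i) fun s => by exact_mod_cast hsum k s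
  exact ⟨fun i => ⨆ s, (u i s : ℝ), ⟨⟨u, hc, fun i => ⟨hmono i, hlim i⟩⟩, hv0,
    summable_of_sum_range_le hv0 hvsum, Real.tsum_le_of_sum_range_le hv0 hvsum⟩, hlim⟩

/-- `m` dominates the semimeasure `2⁻¹ ^ (i + 1)`. -/
theorem IsUniversalSemimeasure.pos {m : ℕ → ℝ} (hm : IsUniversalSemimeasure m) (i : ℕ) :
    0 < m i := by
  obtain ⟨v, hv, hlim⟩ := exists_semimeasure_of_array (u := fun i _ => 2⁻¹ ^ (i + 1))
    (ComputableRat.inv_two_pow (Computable.succ.comp Computable.fst)) (fun i => monotone_const)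
    (fun i s => by positivity) fun k s => by
      have := sum_range_inv_two_pow k
      have h0 : (0 : ℚ) ≤ 2⁻¹ ^ k := by positivity
      simp only [pow_succ]
      rw [← Finset.sum_mul, this]
      linarith
  obtain ⟨c, hc, h⟩ := hm.2 v hv
  have hvi : (0 : ℝ) < v i := by
    rw [← tendsto_nhds_unique tendsto_const_nhds (hlim i)]
    positivity
  exact (mul_pos_iff_of_pos_left hc).1 (hvi.trans_le (h i))

/-- Dividing the terms by an integer `K > α` gives a semimeasure, which `m` dominates. -/
theorem IsUniversalSemimeasure.exists_le_mul {m : ℕ → ℝ} (hm : IsUniversalSemimeasure m)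
    {p : ℕ → ℕ → ℚ} {r : ℕ → ℚ} (hp : IsStagewiseApprox p r) {α : ℝ}
    (hα : HasSum (fun i => (r i : ℝ)) α) : ∃ C : ℝ, ∀ i, (r i : ℝ) ≤ C * m i := by
  obtain ⟨K, hK⟩ := exists_nat_gt α
  have hα0 : 0 ≤ α := hα.nonneg fun i => by exact_mod_cast hp.nonneg_limit i
  have hK0 : (0 : ℚ) < K := by exact_mod_cast hα0.trans_lt hK
  obtain ⟨v, hv, hlim⟩ := exists_semimeasure_of_array (u := fun i t => (K : ℚ)⁻¹ * p i t)
    ((ComputableRat.const _).mul hp.computable)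
    (fun i s t h => mul_le_mul_of_nonneg_left (hp.mono i h) (by positivity))
    (fun i s => mul_nonneg (by positivity) (hp.nonneg i s)) fun k s => by
      have h1 : ∑ i ∈ Finset.range k, p i s ≤ ∑ i ∈ Finset.range (max k s), p i s :=
        Finset.sum_le_sum_of_subset_of_nonneg (Finset.range_mono (le_max_left _ _))
          fun i _ _ => hp.nonneg i s
      rw [← hp.stageSum_eq (le_max_right k s)] at h1
      have h2 : stageSum p s ≤ K := by exact_mod_cast (hp.stageSum_le hα s).trans hK.le
      rw [← Finset.mul_sum, inv_mul_le_iff₀ hK0, mul_one]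
      exact h1.trans h2
  obtain ⟨c, hc, h⟩ := hm.2 v hv
  refine ⟨K * c, fun i => ?_⟩
  have hvi : v i = (K : ℝ)⁻¹ * r i := by
    refine tendsto_nhds_unique (hlim i) (tendsto_const_nhds.congr' ?_)
    filter_upwards [hp.eventually_eq i] with t ht
    rw [ht]
    push_cast
    rfl
  have hK0' : (0 : ℝ) < K := by exact_mod_cast hK0
  have := h i
  rwa [hvi, inv_mul_le_iff₀ hK0', ← mul_assoc] at this

/-- The steps of a monotone sequence span pairwise disjoint open intervals, so their lengths add up
inside `U`. -/
theorem sum_increments_le_of_Ioo_subset {B : ℕ → ℝ} (hB : Monotone B) {U : Set ℝ} {c : ℝ}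
    (hc : 0 ≤ c) (hU : volume U ≤ ENNReal.ofReal c) (F : Finset ℕ)
    (hF : ∀ t ∈ F, Set.Ioo (B t) (B (t + 1)) ⊆ U) : ∑ t ∈ F, (B (t + 1) - B t) ≤ c := by
  have h0 : ∀ t ∈ F, 0 ≤ B (t + 1) - B t := fun t _ => sub_nonneg.2 (hB t.le_succ)
  rw [← ENNReal.ofReal_le_ofReal_iff hc, ENNReal.ofReal_sum_of_nonneg h0]
  calc ∑ t ∈ F, ENNReal.ofReal (B (t + 1) - B t)
      = ∑ t ∈ F, volume (Set.Ioo (B t) (B (t + 1))) := by simp only [Real.volume_Ioo]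
    _ = volume (⋃ t ∈ F, Set.Ioo (B t) (B (t + 1))) :=
        (measure_biUnion_finset (fun i _ j _ hij => hB.pairwise_disjoint_on_Ioo_succ hij)
          fun t _ => measurableSet_Ioo).symm
    _ ≤ volume U := measure_mono (Set.iUnion₂_subset hF)
    _ ≤ _ := hU

theorem ENNReal.inv_two_pow_eq_ofReal (n : ℕ) :
    (2⁻¹ : ENNReal) ^ n = ENNReal.ofReal ((2 : ℝ)⁻¹ ^ n) := by
  rw [ENNReal.ofReal_pow (by positivity), ENNReal.ofReal_inv_of_pos two_pos, ENNReal.ofReal_ofNat]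

/-! ### From a test capturing the sum to a semimeasure dominating the terms -/

section Capture

variable (a b : ℕ → ℕ → ℚ) (p : ℕ → ℕ → ℚ)

/-- The number of the first `s` intervals of level `2 * n + 1` that contain the `t`-th step
of the stage sums. -/
def captureCount (n t s : ℕ) : ℚ :=
  ∑ k ∈ Finset.range s, if a (2 * n + 1) k < stageSum p t then
    (if stageSum p (t + 1) < b (2 * n + 1) k then 1 else 0) else 0

/-- The part of the `i`-th term that is seen by stage `s` to be captured by the test, the levels
weighted by powers of two. -/
def capturedWeight (i s : ℕ) : ℚ :=
  ∑ n ∈ Finset.range s, ∑ t ∈ Finset.range s,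
    if 0 < captureCount a b p n t s then 2 ^ n * (p i (t + 1) - p i t) else 0

variable {a b p}

/-- Only positivity of the count matters; a sum replaces the bounded existential so that capture is
decided by comparing computable rationals. -/
theorem captureCount_pos {n t s : ℕ} : 0 < captureCount a b p n t s ↔
    ∃ k < s, a (2 * n + 1) k < stageSum p t ∧ stageSum p (t + 1) < b (2 * n + 1) k := by
  rw [captureCount, Finset.sum_pos_iff_of_nonneg fun k _ => by split_ifs <;> norm_num]
  refine exists_congr fun k => ?_
  rw [Finset.mem_range]
  refine and_congr_right fun _ => ?_
  split_ifs <;> simp [*]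

theorem computable_captureCount (ha : ComputableRat fun x : ℕ × ℕ => a x.1 x.2)
    (hb : ComputableRat fun x : ℕ × ℕ => b x.1 x.2) (hB : ComputableRat (stageSum p)) :
    ComputableRat fun x : (ℕ × ℕ) × ℕ => captureCount a b p x.1.1 x.1.2 x.2 := by
  have hn : Computable fun y : ((ℕ × ℕ) × ℕ) × ℕ => 2 * y.1.1.1 + 1 :=
    Computable.succ.comp ((Computable.const 2).nat_mul'
      (Computable.fst.comp (Computable.fst.comp Computable.fst)))
  have ht : Computable fun y : ((ℕ × ℕ) × ℕ) × ℕ => y.1.1.2 :=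
    Computable.snd.comp (Computable.fst.comp Computable.fst)
  have hnk := hn.pair (Computable.snd (α := (ℕ × ℕ) × ℕ) (β := ℕ))
  refine ComputableRat.sum_range (f := fun (x : (ℕ × ℕ) × ℕ) k =>
    if a (2 * x.1.1 + 1) k < stageSum p x.1.2 then
    (if stageSum p (x.1.2 + 1) < b (2 * x.1.1 + 1) k then 1 else 0) else 0) ?_ Computable.snd
  exact ComputableRat.ite_lt (ha.comp hnk) (hB.comp ht)
    (ComputableRat.ite_lt (hB.comp (Computable.succ.comp ht)) (hb.comp hnk)
      (ComputableRat.const 1) (ComputableRat.const 0)) (ComputableRat.const 0)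

variable {r : ℕ → ℚ} (hp : IsStagewiseApprox p r)

include hp

theorem computable_capturedWeight (ha : ComputableRat fun x : ℕ × ℕ => a x.1 x.2)
    (hb : ComputableRat fun x : ℕ × ℕ => b x.1 x.2) :
    ComputableRat fun x : ℕ × ℕ => capturedWeight a b p x.1 x.2 := by
  have hi : Computable fun y : ((ℕ × ℕ) × ℕ) × ℕ => y.1.1.1 :=
    Computable.fst.comp (Computable.fst.comp Computable.fst)
  have hs : Computable fun y : ((ℕ × ℕ) × ℕ) × ℕ => y.1.1.2 :=
    Computable.snd.comp (Computable.fst.comp Computable.fst)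
  have hn : Computable fun y : ((ℕ × ℕ) × ℕ) × ℕ => y.1.2 :=
    Computable.snd.comp Computable.fst
  refine ComputableRat.sum_range (f := fun (x : ℕ × ℕ) n => ∑ t ∈ Finset.range x.2,
    if 0 < captureCount a b p n t x.2 then 2 ^ n * (p x.1 (t + 1) - p x.1 t) else 0) ?_
    Computable.snd
  refine ComputableRat.sum_range (f := fun (x : (ℕ × ℕ) × ℕ) t =>
    if 0 < captureCount a b p x.2 t x.1.2 then 2 ^ x.2 * (p x.1.1 (t + 1) - p x.1.1 t) else 0) ?_
    (Computable.snd.comp Computable.fst)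
  have hcount := (computable_captureCount ha hb hp.computable_stageSum).comp
    ((hn.pair Computable.snd).pair hs)
  have hincr := hp.computable_increment.comp (hi.pair Computable.snd)
  exact ComputableRat.ite_lt (ComputableRat.const 0) hcount
    ((ComputableRat.two_pow hn).mul hincr) (ComputableRat.const 0)

theorem capturedWeight_term_nonneg (i n t s : ℕ) :
    0 ≤ if 0 < captureCount a b p n t s then 2 ^ n * (p i (t + 1) - p i t) else 0 := by
  split_ifs
  · exact mul_nonneg (by positivity) (hp.increment_nonneg i t)
  · exact le_rfl

theorem capturedWeight_mono (i : ℕ) : Monotone (capturedWeight a b p i) := by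
  intro s s' hs
  refine (Finset.sum_le_sum fun n _ => Finset.sum_le_sum fun t _ => ?_).trans
    ((Finset.sum_le_sum fun n _ => Finset.sum_le_sum_of_subset_of_nonneg (Finset.range_mono hs)
      fun t _ _ => capturedWeight_term_nonneg hp i n t s').trans
    (Finset.sum_le_sum_of_subset_of_nonneg (Finset.range_mono hs)
      fun n _ _ => Finset.sum_nonneg fun t _ => capturedWeight_term_nonneg hp i n t s'))
  by_cases h : 0 < captureCount a b p n t s
  · obtain ⟨k, hk, h'⟩ := captureCount_pos.1 h
    rw [if_pos h, if_pos (captureCount_pos.2 ⟨k, hk.trans_le hs, h'⟩)]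
  · rw [if_neg h]
    exact capturedWeight_term_nonneg hp i n t s'

theorem sum_captured_increments_le
    (hvol : ∀ n, volume (intervalUnion (a n) (b n)) ≤ (2⁻¹ : ENNReal) ^ n) (n s : ℕ) :
    ∑ t ∈ (Finset.range s).filter (fun t => 0 < captureCount a b p n t s),
      (stageSum p (t + 1) - stageSum p t) ≤ 2⁻¹ ^ (2 * n + 1) := by
  have hmono : Monotone fun t => (stageSum p t : ℝ) := fun t t' h =>
    Rat.cast_le.2 (hp.stageSum_mono h)
  have := sum_increments_le_of_Ioo_subset hmono (c := 2⁻¹ ^ (2 * n + 1)) (by positivity)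
    ((hvol (2 * n + 1)).trans_eq (ENNReal.inv_two_pow_eq_ofReal _))
    ((Finset.range s).filter (fun t => 0 < captureCount a b p n t s)) fun t ht => by
      obtain ⟨k, -, h1, h2⟩ := captureCount_pos.1 (Finset.mem_filter.1 ht).2
      exact (Set.Ioo_subset_Ioo (Rat.cast_le.2 h1.le) (Rat.cast_le.2 h2.le)).trans
        (Set.subset_iUnion (fun k => Set.Ioo (a (2 * n + 1) k : ℝ) (b (2 * n + 1) k : ℝ)) k)
  refine (Rat.cast_le (K := ℝ)).1 ?_
  simpa using this

/-- Level `2n + 1` absorbs the weight: `2 ^ n * 2⁻¹ ^ (2n + 1) = 2⁻¹ ^ (n + 1)`, which sums to at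
most `1`. -/
theorem sum_capturedWeight_le_one
    (hvol : ∀ n, volume (intervalUnion (a n) (b n)) ≤ (2⁻¹ : ENNReal) ^ n) (k s : ℕ) :
    ∑ i ∈ Finset.range k, capturedWeight a b p i s ≤ 1 := by
  have hlevel : ∀ n, ∑ t ∈ Finset.range s, ∑ i ∈ Finset.range k,
      (if 0 < captureCount a b p n t s then 2 ^ n * (p i (t + 1) - p i t) else 0)
        ≤ 2⁻¹ ^ (n + 1) := fun n => by
    calc _ ≤ ∑ t ∈ Finset.range s, if 0 < captureCount a b p n t s then
            2 ^ n * (stageSum p (t + 1) - stageSum p t) else 0 := by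
          refine Finset.sum_le_sum fun t _ => ?_
          split_ifs
          · rw [← Finset.mul_sum, hp.stageSum_succ_sub (le_max_right k (t + 1))]
            refine mul_le_mul_of_nonneg_left ?_ (by positivity)
            exact Finset.sum_le_sum_of_subset_of_nonneg (Finset.range_mono (le_max_left _ _))
              fun i _ _ => hp.increment_nonneg i t
          · simp
      _ = 2 ^ n * ∑ t ∈ (Finset.range s).filter (fun t => 0 < captureCount a b p n t s),
            (stageSum p (t + 1) - stageSum p t) := by
          rw [← Finset.sum_filter, Finset.mul_sum]
      _ ≤ 2 ^ n * 2⁻¹ ^ (2 * n + 1) :=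
          mul_le_mul_of_nonneg_left (sum_captured_increments_le hp hvol n s) (by positivity)
      _ = 2⁻¹ ^ (n + 1) := by
          rw [show 2 * n + 1 = n + (n + 1) by ring, pow_add, ← mul_assoc, ← mul_pow]
          norm_num
  calc ∑ i ∈ Finset.range k, capturedWeight a b p i s
      = ∑ n ∈ Finset.range s, ∑ t ∈ Finset.range s, ∑ i ∈ Finset.range k,
        (if 0 < captureCount a b p n t s then 2 ^ n * (p i (t + 1) - p i t) else 0) := by
        simp only [capturedWeight]
        rw [Finset.sum_comm]
        exact Finset.sum_congr rfl fun n _ => Finset.sum_comm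
    _ ≤ ∑ n ∈ Finset.range s, (2 : ℚ)⁻¹ ^ (n + 1) := Finset.sum_le_sum fun n _ => hlevel n
    _ ≤ 1 := by
        have h0 : (0 : ℚ) ≤ 2⁻¹ ^ s := by positivity
        simp only [pow_succ]
        rw [← Finset.sum_mul, sum_range_inv_two_pow]
        linarith

/-- As `T ≤ i`, the `i`-th term is zero up to stage `T`. All its growth occurs in captured steps and
telescopes. -/
theorem le_capturedWeight {n T k i s : ℕ}
    (hT : ∀ t, T ≤ t → a (2 * n + 1) k < stageSum p t ∧ stageSum p (t + 1) < b (2 * n + 1) k)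
    (hi : T ≤ i) (hn : n < s) (hk : k < s) : 2 ^ n * p i s ≤ capturedWeight a b p i s := by
  calc 2 ^ n * p i s = ∑ t ∈ Finset.range s, 2 ^ n * (p i (t + 1) - p i t) := by
        rw [← Finset.mul_sum, Finset.sum_range_sub, hp.eq_zero i 0 (Nat.zero_le i), sub_zero]
    _ ≤ ∑ t ∈ Finset.range s,
        (if 0 < captureCount a b p n t s then 2 ^ n * (p i (t + 1) - p i t) else 0) := by
        refine Finset.sum_le_sum fun t _ => ?_
        rcases lt_or_ge t T with h | h
        · rw [hp.eq_zero i (t + 1) (by omega), hp.eq_zero i t (by omega)]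
          simp
        · rw [if_pos (captureCount_pos.2 ⟨k, hk, hT t h⟩)]
    _ ≤ capturedWeight a b p i s :=
        Finset.single_le_sum (f := fun n => ∑ t ∈ Finset.range s,
          if 0 < captureCount a b p n t s then 2 ^ n * (p i (t + 1) - p i t) else 0)
          (fun n _ => Finset.sum_nonneg fun t _ => capturedWeight_term_nonneg hp i n t s)
          (Finset.mem_range.2 hn)

/-- If a Martin-Löf test captures the sum, the terms are `o(m i)`. -/
theorem tendsto_ratio_zero_of_captured {α : ℝ} (hα : HasSum (fun i => (r i : ℝ)) α)
    {m : ℕ → ℝ} (hm : IsUniversalSemimeasure m) (hab : IsMartinLofTest a b)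
    (hmem : ∀ n, α ∈ intervalUnion (a n) (b n)) :
    Tendsto (fun i => (r i : ℝ) / m i) atTop (𝓝 0) := by
  obtain ⟨ha, hb, hvol⟩ := hab
  obtain ⟨u, hu, hlim⟩ := exists_semimeasure_of_array (computable_capturedWeight hp ha hb)
    (capturedWeight_mono hp) (fun i s => Finset.sum_nonneg fun n _ => Finset.sum_nonneg
      fun t _ => capturedWeight_term_nonneg hp i n t s) (sum_capturedWeight_le_one hp hvol)
  obtain ⟨c, hc, hcm⟩ := hm.2 u hu
  have hratio : ∀ n : ℕ, ∀ᶠ i in atTop, (r i : ℝ) / m i ≤ c * 2⁻¹ ^ n := fun n => by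
    obtain ⟨k, hk1, hk2⟩ := Set.mem_iUnion.1 (hmem (2 * n + 1))
    obtain ⟨T, hT⟩ := eventually_atTop.1 ((hp.tendsto_stageSum hα).eventually_const_lt hk1)
    have hT' : ∀ t, T ≤ t →
        a (2 * n + 1) k < stageSum p t ∧ stageSum p (t + 1) < b (2 * n + 1) k := fun t ht =>
      ⟨by exact_mod_cast hT t ht, by exact_mod_cast (hp.stageSum_le hα (t + 1)).trans_lt hk2⟩
    filter_upwards [eventually_ge_atTop T] with i hi
    -- The threshold `T` does not depend on `i`; only the stage `s`, sent to infinity, does.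
    have h1 : (2 : ℝ) ^ n * r i ≤ u i := by
      refine ge_of_tendsto (hlim i) ?_
      filter_upwards [eventually_gt_atTop n, eventually_gt_atTop k, hp.eventually_eq i]
        with s hns hks hs
      have := le_capturedWeight hp hT' hi hns hks
      rw [hs] at this
      exact_mod_cast this
    have h2 := h1.trans (hcm i)
    rw [div_le_iff₀ (hm.pos i)]
    calc (r i : ℝ) = 2⁻¹ ^ n * (2 ^ n * r i) := by
          rw [← mul_assoc, ← mul_pow]
          norm_num
      _ ≤ 2⁻¹ ^ n * (c * m i) := mul_le_mul_of_nonneg_left h2 (by positivity)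
      _ = c * 2⁻¹ ^ n * m i := by ring
  have hgeom : Tendsto (fun n : ℕ => c * (2 : ℝ)⁻¹ ^ n) atTop (𝓝 0) := by
    simpa using (tendsto_pow_atTop_nhds_zero_of_lt_one (by norm_num)
      (by norm_num : (2 : ℝ)⁻¹ < 1)).const_mul c
  refine tendsto_order.2 ⟨fun x hx => Eventually.of_forall fun i => hx.trans_le <|
    div_nonneg (by exact_mod_cast hp.nonneg_limit i) (hm.pos i).le, fun x hx => ?_⟩
  obtain ⟨n, hn⟩ := (hgeom.eventually_lt_const hx).exists
  exact (hratio n).mono fun i hi => hi.trans_lt hn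

end Capture

/-! ### A maximal inequality -/

/-- A one-sided maximal inequality: if masses `ν t` sit at the points `x t` of a non-decreasing
sequence, then the points `y` such that some block of masses to the left of `y` outweighs the
distance from its first point to `y` form a set of measure at most the total mass. -/
theorem volume_iUnion_Ioo_le_total_mass {x ν : ℕ → ℝ} (hx : Monotone x) (hν : ∀ t, 0 ≤ ν t)
    {c : ℝ} (hc : ∀ k, ∑ t ∈ Finset.range k, ν t ≤ c) :
    volume (⋃ i, ⋃ l, Set.Ioo (x (i + l)) (x i + ∑ j ∈ Finset.range (l + 1), ν (i + j)))
      ≤ ENNReal.ofReal c := by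
  -- Masses are laid out greedily, as in a queue: mass `k` occupies an interval of length `ν k`
  -- starting at `x k`, or at the end `z k` of the earlier ones if that lies further right.
  let z : ℕ → ℝ := fun k => Nat.rec (x 0) (fun k y => max y (x k) + ν k) k
  have hz : ∀ k, z (k + 1) = max (z k) (x k) + ν k := fun _ => rfl
  have hend : ∀ i l, x i + ∑ j ∈ Finset.range (l + 1), ν (i + j) ≤ z (i + l + 1) := by
    intro i l
    induction l with
    | zero => simp [hz]
    | succ l ih =>
      rw [Finset.sum_range_succ, ← add_assoc, hz]
      exact add_le_add (ih.trans (le_max_left _ _)) le_rfl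
  -- Descending in `k`: a point beyond `x k` that precedes the `k`-th interval must lie before the
  -- end `z k` of the queue, so an earlier interval contains it.
  have hcover : ∀ k y, x k < y → y < z (k + 1) →
      y ∈ ⋃ j, Set.Ico (max (z j) (x j)) (max (z j) (x j) + ν j) := by
    intro k
    induction k with
    | zero => exact fun y h1 h2 => Set.mem_iUnion.2 ⟨0, (max_self (x 0)).trans_le h1.le, h2⟩
    | succ k ih =>
      intro y h1 h2
      rcases le_or_gt (max (z (k + 1)) (x (k + 1))) y with h | h
      · exact Set.mem_iUnion.2 ⟨k + 1, h, h2⟩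
      · exact ih y ((hx k.le_succ).trans_lt h1) ((lt_max_iff.1 h).resolve_right h1.not_gt)
  calc _ ≤ volume (⋃ j, Set.Ico (max (z j) (x j)) (max (z j) (x j) + ν j)) :=
        measure_mono <| Set.iUnion_subset fun i => Set.iUnion_subset fun l y hy =>
          hcover (i + l) y hy.1 (hy.2.trans_le (hend i l))
    _ ≤ ∑' j, volume (Set.Ico (max (z j) (x j)) (max (z j) (x j) + ν j)) := measure_iUnion_le _
    _ = ∑' j, ENNReal.ofReal (ν j) := by simp
    _ ≤ ENNReal.ofReal c := ENNReal.tsum_le_of_sum_range_le fun k => by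
        rw [← ENNReal.ofReal_sum_of_nonneg fun t _ => hν t]
        exact ENNReal.ofReal_le_ofReal (hc k)

/-! ### From terms of order `o(m i)` to a test -/

section Cover

variable (p q : ℕ → ℕ → ℚ)

/-- The scale of the cover of level `n`. -/
def coverScale (n : ℕ) : ℚ := 2⁻¹ ^ (n + 3)

/-- Stage sums, shifted so as to be strictly increasing. -/
def coverPoint (n t : ℕ) : ℚ := stageSum p t - coverScale n * 2⁻¹ ^ t

/-- The mass put by stage `s` at the point `coverPoint p n t`: the sum of those increments
`p i (t + 1) - p i t` for which the value `p i (t + 1)` is already bounded by the approximation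
`q i s` times the scale, plus a small padding. -/
def coverMass (n s t : ℕ) : ℚ :=
  ∑ i ∈ Finset.range (t + 1),
    (if p i (t + 1) < coverScale n * q i s then p i (t + 1) - p i t else 0) +
    2 * coverScale n * 2⁻¹ ^ t

/-- The limit of `coverMass` (or more), for `q i s` tending to `m i`. -/
noncomputable def coverMassLimit (m : ℕ → ℝ) (n t : ℕ) : ℝ :=
  ∑ i ∈ Finset.range (t + 1),
    (if (p i (t + 1) : ℝ) ≤ coverScale n * m i then (p i (t + 1) : ℝ) - p i t else 0) +
    2 * coverScale n * 2⁻¹ ^ t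

/-- Right end of a cover interval: a point plus a block of `l + 1` masses. -/
def coverEnd (n i l s : ℕ) : ℚ :=
  coverPoint p n i + ∑ j ∈ Finset.range (l + 1), coverMass p q n s (i + j)

/-- Left end points of the cover, indexed by coded triples. -/
def coverLeft (n k : ℕ) : ℚ :=
  coverPoint p n (k.unpair.1 + k.unpair.2.unpair.1)

/-- Right end points of the cover, indexed by coded triples. -/
def coverRight (n k : ℕ) : ℚ :=
  coverEnd p q n k.unpair.1 k.unpair.2.unpair.1 k.unpair.2.unpair.2

theorem coverScale_pos (n : ℕ) : 0 < coverScale n := by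
  unfold coverScale
  positivity

variable {p q} {r : ℕ → ℚ} (hp : IsStagewiseApprox p r)

include hp

theorem computable_coverPoint : ComputableRat fun x : ℕ × ℕ => coverPoint p x.1 x.2 := by
  have h3 : Computable fun x : ℕ × ℕ => x.1 + 3 :=
    Computable.fst.nat_add' (Computable.const 3)
  exact (hp.computable_stageSum.comp Computable.snd).sub
    ((ComputableRat.inv_two_pow h3).mul (ComputableRat.inv_two_pow Computable.snd))

theorem computable_coverMass (hq : ComputableRat fun x : ℕ × ℕ => q x.1 x.2) :
    ComputableRat fun x : (ℕ × ℕ) × ℕ => coverMass p q x.1.1 x.1.2 x.2 := by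
  have hscale : ComputableRat coverScale :=
    ComputableRat.inv_two_pow (Computable.id.nat_add' (Computable.const 3))
  have hit : Computable fun y : ((ℕ × ℕ) × ℕ) × ℕ => (y.2, y.1.2) :=
    Computable.snd.pair (Computable.snd.comp Computable.fst)
  have hit' : Computable fun y : ((ℕ × ℕ) × ℕ) × ℕ => (y.2, y.1.2 + 1) :=
    Computable.snd.pair (Computable.succ.comp (Computable.snd.comp Computable.fst))
  have hn : Computable fun y : ((ℕ × ℕ) × ℕ) × ℕ => y.1.1.1 :=
    Computable.fst.comp (Computable.fst.comp Computable.fst)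
  have his : Computable fun y : ((ℕ × ℕ) × ℕ) × ℕ => (y.2, y.1.1.2) :=
    Computable.snd.pair (Computable.snd.comp (Computable.fst.comp Computable.fst))
  refine ComputableRat.add (ComputableRat.sum_range (f := fun (x : (ℕ × ℕ) × ℕ) i =>
    if p i (x.2 + 1) < coverScale x.1.1 * q i x.1.2 then p i (x.2 + 1) - p i x.2 else 0) ?_
    (Computable.succ.comp Computable.snd)) ?_
  · exact ComputableRat.ite_lt (hp.computable.comp hit') ((hscale.comp hn).mul (hq.comp his))
      (hp.computable_increment.comp hit) (ComputableRat.const 0)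
  · exact ((ComputableRat.const 2).mul
      (hscale.comp (Computable.fst.comp Computable.fst))).mul
      (ComputableRat.inv_two_pow Computable.snd)

theorem computable_coverLeft : ComputableRat fun x : ℕ × ℕ => coverLeft p x.1 x.2 := by
  have hu : Computable Nat.unpair := Computable.unpair
  have h1 : Computable fun x : ℕ × ℕ => x.2.unpair := hu.comp Computable.snd
  have h2 : Computable fun x : ℕ × ℕ => x.2.unpair.2.unpair := hu.comp (Computable.snd.comp h1)
  have h := (computable_coverPoint hp).comp (Computable.fst.pair
    ((Computable.fst.comp h1).nat_add' (Computable.fst.comp h2)))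
  exact h

theorem computable_coverRight (hq : ComputableRat fun x : ℕ × ℕ => q x.1 x.2) :
    ComputableRat fun x : ℕ × ℕ => coverRight p q x.1 x.2 := by
  have hu : Computable Nat.unpair := Computable.unpair
  have h1 : Computable fun x : ℕ × ℕ => x.2.unpair := hu.comp Computable.snd
  have h2 : Computable fun x : ℕ × ℕ => x.2.unpair.2.unpair := hu.comp (Computable.snd.comp h1)
  have hi := Computable.fst.comp h1
  have hmass := (computable_coverMass hp hq).comp
    (((Computable.fst.comp (Computable.fst (α := ℕ × ℕ) (β := ℕ))).pair
      ((Computable.snd.comp h2).comp Computable.fst)).pair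
      ((hi.comp Computable.fst).nat_add' Computable.snd))
  have hsum := ComputableRat.sum_range (f := fun (x : ℕ × ℕ) j =>
    coverMass p q x.1 x.2.unpair.2.unpair.2 (x.2.unpair.1 + j)) hmass
    (Computable.succ.comp (Computable.fst.comp h2))
  have hpoint := (computable_coverPoint hp).comp (Computable.fst.pair hi)
  exact hpoint.add hsum

theorem coverPoint_mono (n : ℕ) : Monotone (coverPoint p n) := fun s t h =>
  sub_le_sub (hp.stageSum_mono h) <| mul_le_mul_of_nonneg_left
    (pow_le_pow_of_le_one (by norm_num) (by norm_num) h) (coverScale_pos n).le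

theorem coverMassLimit_nonneg (m : ℕ → ℝ) (n t : ℕ) : 0 ≤ coverMassLimit p m n t := by
  have h : (0 : ℝ) < coverScale n := by exact_mod_cast coverScale_pos n
  refine add_nonneg (Finset.sum_nonneg fun i _ => ?_) (by positivity)
  split_ifs
  · exact_mod_cast hp.increment_nonneg i t
  · exact le_rfl

theorem coverMass_le_limit {m : ℕ → ℝ} (hqm : ∀ i s, (q i s : ℝ) ≤ m i) (n s t : ℕ) :
    (coverMass p q n s t : ℝ) ≤ coverMassLimit p m n t := by
  have hpos : (0 : ℝ) < coverScale n := by exact_mod_cast coverScale_pos n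
  unfold coverMass coverMassLimit
  push_cast
  refine add_le_add (Finset.sum_le_sum fun i _ => ?_) le_rfl
  have h0 : (0 : ℝ) ≤ (p i (t + 1) : ℝ) - p i t := by exact_mod_cast hp.increment_nonneg i t
  by_cases h : p i (t + 1) < coverScale n * q i s
  · have h' : (p i (t + 1) : ℝ) ≤ coverScale n * m i := by
      refine le_trans ?_ (mul_le_mul_of_nonneg_left (hqm i s) hpos.le)
      exact_mod_cast h.le
    rw [if_pos h, if_pos h', Rat.cast_sub]
  · rw [if_neg h, Rat.cast_zero]
    split_ifs
    · exact h0
    · exact le_rfl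

theorem sum_bounded_increments_le (i k : ℕ) {c : ℝ} (hc : 0 ≤ c) :
    ∑ t ∈ Finset.range k, (if (p i (t + 1) : ℝ) ≤ c then (p i (t + 1) : ℝ) - p i t else 0) ≤ c := by
  -- The bound by the current value `p i k` is carried along so that a counted increment telescopes
  -- to `p i (k + 1) ≤ c`.
  suffices h : ∑ t ∈ Finset.range k,
      (if (p i (t + 1) : ℝ) ≤ c then (p i (t + 1) : ℝ) - p i t else 0) ≤ min (p i k : ℝ) c from
    h.trans (min_le_right _ _)
  induction k with
  | zero => simp [hp.eq_zero i 0 (Nat.zero_le i), hc]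
  | succ k ih =>
    obtain ⟨h1, h2⟩ := le_min_iff.1 ih
    have hm : (p i k : ℝ) ≤ p i (k + 1) := by exact_mod_cast hp.mono i k.le_succ
    rw [Finset.sum_range_succ]
    split_ifs with h
    · exact le_min (by linarith) (by linarith)
    · exact le_min (by linarith) (by linarith)

/-- Each term contributes at most `coverScale n * m i`, in all one scale; the padding adds at most
four. The scale is `2⁻¹ ^ n / 8`, so five scales fit. -/
theorem sum_coverMassLimit_le {m : ℕ → ℝ} (hm : IsLowerSemicomputableSemimeasure m) (n k : ℕ) :
    ∑ t ∈ Finset.range k, coverMassLimit p m n t ≤ 2⁻¹ ^ n := by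
  have hpos : (0 : ℝ) < coverScale n := by exact_mod_cast coverScale_pos n
  have hscale : (coverScale n : ℝ) = 2⁻¹ ^ n / 8 := by
    unfold coverScale
    push_cast
    ring
  have h1 : ∑ t ∈ Finset.range k, ∑ i ∈ Finset.range (t + 1),
      (if (p i (t + 1) : ℝ) ≤ coverScale n * m i then (p i (t + 1) : ℝ) - p i t else 0)
        ≤ coverScale n := by
    calc _ ≤ ∑ t ∈ Finset.range k, ∑ i ∈ Finset.range k,
        (if (p i (t + 1) : ℝ) ≤ coverScale n * m i then (p i (t + 1) : ℝ) - p i t else 0) := by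
          refine Finset.sum_le_sum fun t ht => Finset.sum_le_sum_of_subset_of_nonneg
            (Finset.range_mono (Finset.mem_range.1 ht)) fun i _ _ => ?_
          split_ifs
          · exact_mod_cast hp.increment_nonneg i t
          · exact le_rfl
      _ ≤ ∑ i ∈ Finset.range k, coverScale n * m i := by
          rw [Finset.sum_comm]
          exact Finset.sum_le_sum fun i _ =>
            sum_bounded_increments_le hp i k (mul_nonneg hpos.le (hm.nonneg i))
      _ ≤ coverScale n * 1 := by
          rw [← Finset.mul_sum]
          exact mul_le_mul_of_nonneg_left ((hm.summable.sum_le_tsum _ fun i _ =>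
            hm.nonneg i).trans hm.tsum_le_one) hpos.le
      _ = coverScale n := mul_one _
  have h2 : ∑ t ∈ Finset.range k, ((2 : ℝ)⁻¹) ^ t = 2 - 2 * (2 : ℝ)⁻¹ ^ k := by
    simpa using congrArg (Rat.cast : ℚ → ℝ) (sum_range_inv_two_pow k)
  simp only [coverMassLimit]
  rw [Finset.sum_add_distrib, ← Finset.mul_sum, h2]
  have h3 : (0 : ℝ) ≤ 2⁻¹ ^ k := by positivity
  nlinarith [mul_nonneg hpos.le h3]

theorem volume_cover_le {m : ℕ → ℝ} (hm : IsLowerSemicomputableSemimeasure m)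
    (hqm : ∀ i s, (q i s : ℝ) ≤ m i) (n : ℕ) :
    volume (intervalUnion (coverLeft p n) (coverRight p q n)) ≤ (2⁻¹ : ENNReal) ^ n := by
  have hx : Monotone fun t => (coverPoint p n t : ℝ) := fun s t h =>
    Rat.cast_le.2 (coverPoint_mono hp n h)
  rw [ENNReal.inv_two_pow_eq_ofReal]
  refine (measure_mono ?_).trans (volume_iUnion_Ioo_le_total_mass hx
    (coverMassLimit_nonneg hp m n) (sum_coverMassLimit_le hp hm n))
  refine Set.iUnion_subset fun k => Set.Subset.trans ?_
    (Set.subset_iUnion_of_subset k.unpair.1 (Set.subset_iUnion _ k.unpair.2.unpair.1))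
  refine Set.Ioo_subset_Ioo le_rfl ?_
  unfold coverRight coverEnd
  push_cast
  exact add_le_add le_rfl (Finset.sum_le_sum fun j _ => coverMass_le_limit hp hqm n _ _)

/-- Terms below `N` no longer move and the others are counted in full, so the masses telescope to
the growth of the stage sum. The padding at `T` alone is twice the shift in `coverPoint`: half
cancels the shift and half is the surplus. -/
theorem stageSum_le_coverEnd {n N T l s : ℕ} (hconst : ∀ i < N, ∀ t ≥ T, p i t = r i)
    (hs : ∀ i, N ≤ i → i < T + l + 1 → ∀ t ≤ T + l, p i (t + 1) < coverScale n * q i s) :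
    stageSum p (T + l + 1) + coverScale n * 2⁻¹ ^ T ≤ coverEnd p q n T l s := by
  have hpos := coverScale_pos n
  have hmass : ∀ j ∈ Finset.range (l + 1),
      stageSum p (T + (j + 1)) - stageSum p (T + j) + 2 * coverScale n * 2⁻¹ ^ (T + j)
        ≤ coverMass p q n s (T + j) := fun j hj => by
    have hj := Finset.mem_range.1 hj
    refine add_le_add ?_ le_rfl
    rw [← add_assoc, hp.stageSum_succ_sub le_rfl]
    refine Finset.sum_le_sum fun i hi => ?_
    have hi := Finset.mem_range.1 hi
    rcases lt_or_ge i N with hiN | hiN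
    · rw [hconst i hiN _ (by omega), hconst i hiN _ (by omega)]
      simp
    · rw [if_pos (hs i hiN (by omega) (T + j) (by omega))]
  have hpad : 2 * coverScale n * 2⁻¹ ^ T ≤
      ∑ j ∈ Finset.range (l + 1), 2 * coverScale n * 2⁻¹ ^ (T + j) :=
    Finset.single_le_sum (f := fun j => 2 * coverScale n * (2 : ℚ)⁻¹ ^ (T + j))
      (fun j _ => by positivity) (Finset.mem_range.2 l.succ_pos)
  have hsum := Finset.sum_le_sum hmass
  rw [Finset.sum_add_distrib, Finset.sum_range_sub (fun j => stageSum p (T + j))] at hsum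
  unfold coverEnd coverPoint
  rw [← add_assoc, add_zero] at hsum
  linarith

theorem mem_cover {α : ℝ} (hα : HasSum (fun i => (r i : ℝ)) α) {m : ℕ → ℝ}
    (hqm : ∀ i, Tendsto (fun s => (q i s : ℝ)) atTop (𝓝 (m i))) {n : ℕ}
    (hr : ∀ᶠ i in atTop, (r i : ℝ) < coverScale n * m i) :
    α ∈ intervalUnion (coverLeft p n) (coverRight p q n) := by
  have hpos : (0 : ℝ) < coverScale n := by exact_mod_cast coverScale_pos n
  obtain ⟨N, hN⟩ := eventually_atTop.1 hr
  obtain ⟨T, hT⟩ := eventually_atTop.1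
    ((eventually_all_finset (Finset.range N)).2 fun i _ => hp.eventually_eq i)
  have hconst : ∀ i < N, ∀ t ≥ T, p i t = r i := fun i hi t ht =>
    hT t ht i (Finset.mem_range.2 hi)
  -- The surplus at the right end is fixed by `T`, so the block is taken long enough for the stage
  -- sum to come within it of `α`.
  have hlt : α - coverScale n * 2⁻¹ ^ T < α := sub_lt_self _ (by positivity)
  obtain ⟨K, hK⟩ := eventually_atTop.1 ((hp.tendsto_stageSum hα).eventually_const_lt hlt)
  have hKT := hK (T + K + 1) (by omega)
  -- A fixed block involves finitely many indices, so one stage `s` certifies all the strict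
  -- inequalities.
  have hev : ∀ᶠ s in atTop, ∀ i ∈ Finset.range (T + K + 1), N ≤ i →
      (r i : ℝ) < coverScale n * q i s :=
    (eventually_all_finset _).2 fun i _ => by
      by_cases hi : N ≤ i
      · exact (((hqm i).const_mul _).eventually_const_lt (hN i hi)).mono fun s hs _ => hs
      · exact Eventually.of_forall fun s h => absurd h hi
  obtain ⟨s, hs⟩ := hev.exists
  have hend := stageSum_le_coverEnd hp (q := q) (n := n) (l := K) (s := s) hconst
    fun i hNi hi t _ => (hp.le i (t + 1)).trans_lt
      (by exact_mod_cast hs i (Finset.mem_range.2 hi) hNi)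
  refine Set.mem_iUnion.2 ⟨Nat.pair T (Nat.pair K s), ?_, ?_⟩
  · simp only [coverLeft, Nat.unpair_pair]
    have h1 := hp.stageSum_le hα (T + K)
    unfold coverPoint
    push_cast
    -- The shift makes the left inequality strict even if the stage sum already equals `α`.
    have h2 : (0 : ℝ) < coverScale n * 2⁻¹ ^ (T + K) := by positivity
    linarith
  · simp only [coverRight, Nat.unpair_pair]
    have h1 : (stageSum p (T + K + 1) : ℝ) + coverScale n * 2⁻¹ ^ T ≤ coverEnd p q n T K s := by
      simpa using (Rat.cast_le (K := ℝ)).2 hend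
    linarith

/-- If the terms are `o(m i)`, some Martin-Löf test captures the sum. -/
theorem exists_test_of_tendsto_ratio_zero {α : ℝ} (hα : HasSum (fun i => (r i : ℝ)) α)
    {m : ℕ → ℝ} (hm : IsUniversalSemimeasure m)
    (hr : Tendsto (fun i => (r i : ℝ) / m i) atTop (𝓝 0)) :
    ∃ a b, IsMartinLofTest a b ∧ ∀ n, α ∈ intervalUnion (a n) (b n) := by
  obtain ⟨q, hqc, hq⟩ := hm.1.lowerSemicomputable
  have hqm : ∀ i s, (q i s : ℝ) ≤ m i := fun i s =>
    Monotone.ge_of_tendsto (f := fun s => (q i s : ℝ))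
      (fun s t h => Rat.cast_le.2 ((hq i).1 h)) (hq i).2 s
  refine ⟨coverLeft p, coverRight p q, ⟨computable_coverLeft hp, computable_coverRight hp hqc,
    volume_cover_le hp hm.1 hqm⟩, fun n => mem_cover hp hα (fun i => (hq i).2) ?_⟩
  have hpos : (0 : ℝ) < coverScale n := by exact_mod_cast coverScale_pos n
  filter_upwards [hr.eventually_lt_const hpos] with i hi
  exact (div_lt_iff₀ (hm.pos i)).1 hi

end Cover

/-! ### The randomness criterion -/

theorem mainTheorem9 (m : ℕ → ℝ) (hm : IsUniversalSemimeasure m)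
    (r : ℕ → ℚ) (hr : FinitelyApproximable r) (hr0 : ∀ i, 0 ≤ r i)
    (α : ℝ) (hα : HasSum (fun i => (r i : ℝ)) α) :
    (IsMartinLofRandom α ↔ ConvergesSlowly m r) ∧
    (IsMartinLofRandom α ↔ ¬ Tendsto (fun i => (r i : ℝ) / m i) atTop (𝓝 0)) := by
  obtain ⟨p, hp⟩ := hr.exists_stagewiseApprox hr0
  have hrandom : IsMartinLofRandom α ↔ ¬ Tendsto (fun i => (r i : ℝ) / m i) atTop (𝓝 0) := by
    constructor
    · intro h ht
      obtain ⟨a, b, hab, hmem⟩ := exists_test_of_tendsto_ratio_zero hp hα hm ht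
      obtain ⟨n, hn⟩ := h a b hab
      exact hn (hmem n)
    · intro h a b hab
      by_contra! hmem
      exact h (tendsto_ratio_zero_of_captured hp hα hm hab hmem)
  have hslow : ConvergesSlowly m r ↔ ¬ Tendsto (fun i => (r i : ℝ) / m i) atTop (𝓝 0) := by
    constructor
    · rintro ⟨-, ε, hε, hfreq⟩ ht
      refine hfreq ((ht.eventually_lt_const hε).mono fun i hi => not_le.2 ?_)
      exact (div_lt_iff₀ (hm.pos i)).1 hi
    · intro h
      refine ⟨hm.exists_le_mul hp hα, ?_⟩
      -- If every `ε > 0` fails, then `r i < ε * m i` eventually for each `ε`, which is convergence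
      -- of the ratio to zero.
      by_contra! hcon
      refine h (tendsto_order.2 ⟨fun x hx => Eventually.of_forall fun i => hx.trans_le <|
        div_nonneg (by exact_mod_cast hr0 i) (hm.pos i).le, fun x hx => ?_⟩)
      exact (hcon x hx).mono fun i hi => (div_lt_iff₀ (hm.pos i)).2 (not_le.1 (by simpa using hi))
  exact ⟨hrandom.trans hslow.symm, hrandom⟩
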